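/- Let $E$ be a Hausdorff locally convex real topological vector space, let $K\subset E$ be a compact convex set, and let $B\subset K$ be a boundary of $K$, i.e. every continuous affine function $f\colon K\to\mathbb{R}$ attains its maximum over $K$ at some point of $B$. Let $A_1(K)$ be the set of all continuous affine functions $f\colon K\to\mathbb{R}$ with $\sup_{x\in K}|f(x)|\le 1$, endowed with the topology $\tau_p(B)$ of pointwise convergence on $B$. Then $$w(K)=d_s\bigl((A_1(K),\tau_p(B))\bigr).$$ Here $w(X)=\min\{|\mathcal B| : \mathcal B \text{ is a base of } X\}+\omega$ is the weight of a topological space $X$, and $d_s(X)=\min\{|S| : S\subset X \text{ is sequentially dense in } X\}+\omega$ is its sequential density, where $S$ is sequentially dense in $X$ if every point of $X$ is the limit of a sequence of points of $S$. -/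

import Mathlib

open Set Filter Topology Cardinal

universe u

/-- The weight of a topological space: the least cardinality of a base, plus `ℵ₀`. -/
noncomputable def weight (X : Type u) [TopologicalSpace X] : Cardinal.{u} :=
  sInf {κ : Cardinal.{u} | ∃ 𝓑 : Set (Set X), TopologicalSpace.IsTopologicalBasis 𝓑 ∧ #𝓑 = κ} + ℵ₀

/-- `S` is sequentially dense: every point is the limit of a sequence of points of `S`. -/
def SeqDense {X : Type u} (t : TopologicalSpace X) (S : Set X) : Prop :=
  ∀ x : X, ∃ s : ℕ → X, (∀ n, s n ∈ S) ∧ Tendsto s atTop (@nhds X t x)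

/-- The sequential density of a topological space: the least cardinality of a sequentially dense
subset, plus `ℵ₀`. The topology is an explicit argument. -/
noncomputable def seqDensity (X : Type u) (t : TopologicalSpace X) : Cardinal.{u} :=
  sInf {κ : Cardinal.{u} | ∃ S : Set X, SeqDense t S ∧ #S = κ} + ℵ₀

section ConvexCompact

variable {E : Type u} [AddCommGroup E] [Module ℝ E] [TopologicalSpace E]

/-- The set `A(K)` of continuous affine real functions on a (convex) subset `K`. -/
def affineFunctions (K : Set E) : Set C(K, ℝ) :=
  {f | ∀ x y z : K, ∀ a b : ℝ, 0 ≤ a → 0 ≤ b → a + b = 1 →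
    (z : E) = a • (x : E) + b • (y : E) → f z = a * f x + b * f y}

/-- The closed unit ball `A₁(K)` of `A(K)` in the supremum norm. -/
def affineUnitBall (K : Set E) : Set C(K, ℝ) :=
  {f | f ∈ affineFunctions K ∧ ∀ x : K, |f x| ≤ 1}

/-- `B ⊆ K` is a boundary of `K`: every continuous affine function on `K` attains its maximum
over `K` at some point of `B`. -/
def IsBoundary (K : Set E) (B : Set K) : Prop :=
  ∀ f ∈ affineFunctions K, ∃ b ∈ B, ∀ x : K, f x ≤ f b

/-- The topology on `A₁(K)` of pointwise convergence on `B`: the coarsest one for which all the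
evaluations `f ↦ f b`, `b ∈ B`, are continuous. -/
@[reducible] def pointwiseTopology (K : Set E) (B : Set K) : TopologicalSpace (affineUnitBall K) :=
  TopologicalSpace.induced (fun (f : affineUnitBall K) (b : B) => (f : C(K, ℝ)) (b : K))
    Pi.topologicalSpace

end ConvexCompact

/-! Let `S` be sequentially dense for `τ_p(B)`. By Rainwater–Simons, a bounded sequence in `A(K)`
converging pointwise on `B` converges at every point of `K`. So points of `K` not separated by `S`
are not separated by `A₁(K)`, hence coincide by Hahn–Banach. Thus `K` embeds in `ℝ^S`, and its
weight is at most `#S + ℵ₀`. Conversely, `C(K, ℝ)` has a base of size at most `weight K`, so `A₁(K)`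
has a norm-dense subset of that size. Uniform limits are pointwise limits, so this subset is
sequentially dense. -/

/-! ### Simons' argument and the Rainwater–Simons theorem -/

section Simons

variable {X : Type*} [TopologicalSpace X] [CompactSpace X]

/-- Simons' argument: if a bounded sequence in a closed subspace with boundary `B` stays above `ε`
at some point, then it is frequently above `ε / 4` at some point of `B`. -/
theorem exists_boundary_frequently_gt (A : Submodule ℝ C(X, ℝ)) (hA : IsClosed (A : Set C(X, ℝ)))
    (B : Set X) (hB : ∀ f ∈ A, ∃ b ∈ B, ∀ x, f x ≤ f b) (f : ℕ → C(X, ℝ)) (hfA : ∀ n, f n ∈ A)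
    (C : ℝ) (hC : ∀ n, ‖f n‖ ≤ C) (x : X) (ε : ℝ) (hε : 0 < ε) (hx : ∀ n, ε ≤ f n x) :
    ∃ b ∈ B, ∀ n, ∃ k ≥ n, ε / 4 < f k b := by
  have : Nonempty X := ⟨x⟩
  set p : C(X, ℝ) → ℝ := fun g => ⨆ t, g t with hp
  have hle : ∀ (g : C(X, ℝ)) t, g t ≤ p g := fun g t =>
    le_ciSup (isCompact_range g.continuous).bddAbove t
  set D : ℕ → Set C(X, ℝ) := fun n => closedConvexHull ℝ (f '' Ici n) with hD
  have hDmin : ∀ (n : ℕ) (s : Set C(X, ℝ)), Convex ℝ s → IsClosed s → (∀ k ≥ n, f k ∈ s) →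
      D n ⊆ s := fun n s hs hs' h =>
    closedConvexHull_min (by rintro _ ⟨k, hk, rfl⟩; exact h k hk) hs hs'
  have hDA : ∀ n, ∀ g ∈ D n, g ∈ A := fun n =>
    hDmin n A A.convex hA fun k _ => hfA k
  have hDC : ∀ n, ∀ g ∈ D n, ‖g‖ ≤ C := fun n g hg => by
    have := hDmin n (Metric.closedBall 0 C) (convex_closedBall _ _) Metric.isClosed_closedBall
      (fun k _ => by simpa using hC k) hg
    simpa using this
  have hev : ∀ t, IsLinearMap ℝ (fun g : C(X, ℝ) => g t) := fun t => ⟨fun _ _ => rfl, fun _ _ => rfl⟩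
  have hDx : ∀ n, ∀ g ∈ D n, ε ≤ g x := fun n =>
    hDmin n {g | ε ≤ g x} (convex_halfSpace_ge (hev x) ε)
      (isClosed_le continuous_const (continuous_eval_const x)) fun k _ => hx k
  have hDt : ∀ n t c, (∀ k ≥ n, f k t ≤ c) → ∀ g ∈ D n, g t ≤ c := fun n t c h =>
    hDmin n {g | g t ≤ c} (convex_halfSpace_le (hev t) c)
      (isClosed_le (continuous_eval_const t) continuous_const) h
  have hDf : ∀ n, f n ∈ D n := fun n => subset_closedConvexHull ⟨n, self_mem_Ici, rfl⟩
  have hDanti : ∀ m n, m ≤ n → D n ⊆ D m := fun m n h =>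
    hDmin n _ convex_closedConvexHull isClosed_closedConvexHull
      fun k hk => subset_closedConvexHull ⟨k, h.trans hk, rfl⟩
  -- Near-minimizers of `p (s + 2⁻ⁿ g)` over `D n`; the infimum is finite because elements of `D n`
  -- are positive at `x`. The errors stay summable after multiplication by `2 ^ n`.
  have hG : ∀ (n : ℕ) (s : C(X, ℝ)), ∃ g ∈ D n, ∀ h ∈ D n,
      p (s + (1 / 2 : ℝ) ^ n • g) ≤ p (s + (1 / 2 : ℝ) ^ n • h) + ε / 4 * (1 / 4) ^ n := by
    intro n s
    set T : Set ℝ := (fun g => p (s + (1 / 2 : ℝ) ^ n • g)) '' D n with hT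
    have hTne : T.Nonempty := ⟨_, _, hDf n, rfl⟩
    have hTb : BddBelow T := by
      refine ⟨s x, ?_⟩
      rintro _ ⟨g, hg, rfl⟩
      refine le_trans ?_ (hle _ x)
      have h1 := hDx n g hg
      have : 0 ≤ (1 / 2 : ℝ) ^ n * g x := mul_nonneg (by positivity) (by linarith)
      simpa using this
    obtain ⟨_, ⟨g, hg, rfl⟩, hlt⟩ := exists_lt_of_csInf_lt hTne
      (show sInf T < sInf T + ε / 4 * (1 / 4) ^ n by
        have : 0 < ε / 4 * (1 / 4 : ℝ) ^ n := by positivity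
        linarith)
    refine ⟨g, hg, fun h hh => ?_⟩
    have := csInf_le hTb ⟨h, hh, rfl⟩
    simp only at hlt this ⊢
    linarith
  choose G hGD hGle using hG
  -- The step is half the weight `2⁻ⁿ` used in the minimization, so the later steps have total
  -- weight `2⁻ⁿ` and `s (n + 1)` is the midpoint of `s n` and `s n + 2⁻ⁿ G n (s n)`.
  set s : ℕ → C(X, ℝ) := fun n => Nat.rec 0 (fun n s => s + (1 / 2 : ℝ) ^ (n + 1) • G n s) n with hs
  have hs0 : s 0 = 0 := rfl
  have hss : ∀ n, s (n + 1) = s n + (1 / 2 : ℝ) ^ (n + 1) • G n (s n) := fun n => rfl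
  have hCauchy : CauchySeq s := by
    refine cauchySeq_of_le_geometric (1 / 2) (C / 2) (by norm_num) fun n => ?_
    rw [hss, dist_self_add_right, norm_smul, Real.norm_of_nonneg (by positivity), pow_succ]
    have := hDC n _ (hGD n (s n))
    have h2 : (0 : ℝ) ≤ (1 / 2) ^ n := by positivity
    nlinarith [mul_le_mul_of_nonneg_left this h2]
  obtain ⟨S, hS⟩ := cauchySeq_tendsto_of_complete hCauchy
  -- The partial sum is a combination of elements of `D n` of total weight `1 - 2⁻ʲ`; the term in
  -- `d` supplies the missing weight.
  have hpart : ∀ n j, ∀ d ∈ D n,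
      (2 : ℝ) ^ n • (s (n + j) - s n) + (1 / 2 : ℝ) ^ j • d ∈ D n := by
    intro n j
    induction j with
    | zero => intro d hd; simpa using hd
    | succ j ih =>
      intro d hd
      have h1 : (1 / 2 : ℝ) • G (n + j) (s (n + j)) + (1 / 2 : ℝ) • d ∈ D n :=
        convex_closedConvexHull (hDanti n (n + j) (Nat.le_add_right _ _) (hGD _ _)) hd
          (by norm_num) (by norm_num) (by norm_num)
      convert ih _ h1 using 1
      rw [← add_assoc n j 1, hss]
      have h2 : (2 : ℝ) ^ n * (1 / 2) ^ (n + j + 1) = (1 / 2) ^ j * (1 / 2) := by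
        rw [pow_succ, pow_add]
        have : (2 : ℝ) ^ n * (1 / 2) ^ n = 1 := by rw [← mul_pow]; norm_num
        linear_combination ((1 / 2 : ℝ) ^ j * (1 / 2)) * this
      rw [add_sub_right_comm, smul_add, smul_smul, h2, smul_add, smul_smul, smul_smul, pow_succ,
        add_assoc]
  have hrest : ∀ n, (2 : ℝ) ^ n • (S - s n) ∈ D n := by
    intro n
    have h1 : Tendsto (fun j => (2 : ℝ) ^ n • (s (n + j) - s n) + (1 / 2 : ℝ) ^ j • f n) atTop
        (𝓝 ((2 : ℝ) ^ n • (S - s n) + (0 : ℝ) • f n)) := by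
      have h2 : Tendsto (fun j => s (n + j)) atTop (𝓝 S) := by
        simpa [add_comm] using (tendsto_add_atTop_iff_nat n).2 hS
      exact ((h2.sub_const _).const_smul _).add
        ((tendsto_pow_atTop_nhds_zero_of_lt_one (by norm_num) (by norm_num)).smul_const _)
    rw [zero_smul, add_zero] at h1
    exact isClosed_closedConvexHull.mem_of_tendsto h1
      (Eventually.of_forall fun j => hpart n j _ (hDf n))
  have hS0 : S ∈ D 0 := by simpa [hs0] using hrest 0
  obtain ⟨b, hbB, hb⟩ := hB S (hDA 0 S hS0)
  have hpS : p S = S b := le_antisymm (ciSup_le hb) (hle S b)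
  -- Since `2 ^ n • (S - s n)` competes in the `n`-th minimization and turns `s n` into `S`, the
  -- right side drops by at most `ε / 4 * 2⁻ⁿ` from `n` to `n + 1`. It starts at `S b ≥ S x ≥ ε` and
  -- loses at most `ε / 2` in all.
  have hkey : ∀ n, ε / 2 + ε / 2 * (1 / 2) ^ n ≤ (2 : ℝ) ^ n * (S b - s n b) := by
    intro n
    induction n with
    | zero =>
      have := hDx 0 S hS0
      have h2 := hb x
      simp [hs0]; linarith
    | succ n ih =>
      have h1 := hGle n (s n) _ (hrest n)
      have h0 : (1 / 2 : ℝ) ^ n * 2 ^ n = 1 := by rw [← mul_pow]; norm_num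
      rw [smul_smul, h0, one_smul, add_sub_cancel, hpS] at h1
      have h2 := (hle _ b).trans h1
      have h3 : s (n + 1) b = s n b + (1 / 2 : ℝ) ^ (n + 1) * G n (s n) b := by rw [hss]; rfl
      have h4 : (s n + (1 / 2 : ℝ) ^ n • G n (s n)) b = s n b + (1 / 2 : ℝ) ^ n * G n (s n) b := rfl
      rw [h4] at h2
      have h5 : (2 : ℝ) ^ n * (1 / 4) ^ n = (1 / 2) ^ n := by rw [← mul_pow]; norm_num
      have h6 := mul_le_mul_of_nonneg_left h2 (show (0 : ℝ) ≤ 2 ^ n by positivity)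
      rw [h3]
      rw [pow_succ, pow_succ]
      have h7 : (2 : ℝ) ^ n * (S b + ε / 4 * (1 / 4) ^ n) = 2 ^ n * S b + ε / 4 * (1 / 2) ^ n := by
        rw [← h5]; ring
      rw [h7] at h6
      linear_combination ih + h6
  refine ⟨b, hbB, fun n => ?_⟩
  by_contra! hcon
  -- A bound on the tail at `b` passes to its closed convex hull, against `hkey`.
  have h1 := hDt n b (ε / 4) hcon _ (hrest n)
  have h2 : ((2 : ℝ) ^ n • (S - s n)) b = (2 : ℝ) ^ n * (S b - s n b) := rfl
  rw [h2] at h1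
  have h3 := hkey n
  have h4 : 0 < ε / 2 * (1 / 2 : ℝ) ^ n := by positivity
  linarith

/-- The Rainwater–Simons theorem, upper half. -/
theorem eventually_lt_of_boundary (A : Submodule ℝ C(X, ℝ)) (hA : IsClosed (A : Set C(X, ℝ)))
    (B : Set X) (hB : ∀ f ∈ A, ∃ b ∈ B, ∀ x, f x ≤ f b) (f : ℕ → C(X, ℝ)) (hfA : ∀ n, f n ∈ A)
    (C : ℝ) (hC : ∀ n, ‖f n‖ ≤ C) (hlim : ∀ b ∈ B, Tendsto (fun n => f n b) atTop (𝓝 0))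
    (x : X) (ε : ℝ) (hε : 0 < ε) : ∀ᶠ n in atTop, f n x < ε := by
  by_contra hcon
  have hfreq : ∃ᶠ n in atTop, ε ≤ f n x := by
    simpa [Filter.Frequently] using hcon
  -- Simons' argument needs the lower bound at every index, hence the subsequence.
  obtain ⟨φ, hφ, hφx⟩ := extraction_of_frequently_atTop hfreq
  obtain ⟨b, hb, h⟩ := exists_boundary_frequently_gt A hA B hB (f ∘ φ) (fun n => hfA _) C
    (fun n => hC _) x ε hε hφx
  obtain ⟨N, hN⟩ := eventually_atTop.1
    (((hlim b hb).comp hφ.tendsto_atTop).eventually_lt_const (show 0 < ε / 4 by positivity))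
  obtain ⟨k, hk, hk'⟩ := h N
  exact lt_asymm hk' (hN k hk)

/-- The Rainwater–Simons theorem: a bounded sequence in a closed subspace of `C(X)` which converges
pointwise to `0` on a boundary converges pointwise to `0`. -/
theorem tendsto_zero_of_boundary (A : Submodule ℝ C(X, ℝ)) (hA : IsClosed (A : Set C(X, ℝ)))
    (B : Set X) (hB : ∀ f ∈ A, ∃ b ∈ B, ∀ x, f x ≤ f b) (f : ℕ → C(X, ℝ)) (hfA : ∀ n, f n ∈ A)
    (C : ℝ) (hC : ∀ n, ‖f n‖ ≤ C) (hlim : ∀ b ∈ B, Tendsto (fun n => f n b) atTop (𝓝 0))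
    (x : X) : Tendsto (fun n => f n x) atTop (𝓝 0) := by
  refine tendsto_order.2 ⟨fun a ha => ?_, fun a ha => ?_⟩
  · have := eventually_lt_of_boundary A hA B hB (fun n => -f n) (fun n => A.neg_mem (hfA n)) C
      (fun n => by simpa using hC n) (fun b hb => by simpa using (hlim b hb).neg) x (-a)
      (by linarith)
    filter_upwards [this] with n hn
    simpa using hn
  · exact eventually_lt_of_boundary A hA B hB f hfA C hC hlim x a ha

end Simons


/-! ### Cardinality of bases and dense sets -/

section Weight

theorem mk_finite_subsets_le {α : Type u} (s : Set α) {κ : Cardinal.{u}} (hκ : ℵ₀ ≤ κ)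
    (hs : #s ≤ κ) : #{t : Set α | t.Finite ∧ t ⊆ s} ≤ κ := by
  have h1 : #{t : Set α | t.Finite ∧ t ⊆ s} ≤ #(Finset s) := by
    refine mk_le_of_surjective (f := fun t : Finset s =>
      (⟨(↑) '' (t : Set s), t.finite_toSet.image _, by simp⟩ :
        {t : Set α | t.Finite ∧ t ⊆ s})) ?_
    rintro ⟨t, ht, hts⟩
    refine ⟨(ht.preimage Subtype.val_injective.injOn).toFinset, ?_⟩
    ext x
    simpa using fun hx => hts hx
  refine h1.trans ?_
  cases finite_or_infinite s with
  | inl h => exact (lt_aleph0_of_finite _).le.trans hκ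
  | inr h => rwa [mk_finset_of_infinite]

theorem exists_isTopologicalBasis_of_generateFrom {X : Type u} [t : TopologicalSpace X]
    {s : Set (Set X)} (hs : t = .generateFrom s) {κ : Cardinal.{u}} (hκ : ℵ₀ ≤ κ) (h : #s ≤ κ) :
    ∃ 𝓑 : Set (Set X), TopologicalSpace.IsTopologicalBasis 𝓑 ∧ #𝓑 ≤ κ :=
  ⟨_, TopologicalSpace.isTopologicalBasis_of_subbasis hs,
    mk_image_le.trans (mk_finite_subsets_le s hκ h)⟩

theorem aleph0_le_weight (X : Type u) [TopologicalSpace X] : ℵ₀ ≤ weight X := self_le_add_left _ _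

theorem weight_le {X : Type u} [TopologicalSpace X] {κ : Cardinal.{u}} (hκ : ℵ₀ ≤ κ)
    {𝓑 : Set (Set X)} (h𝓑 : TopologicalSpace.IsTopologicalBasis 𝓑) (h : #𝓑 ≤ κ) :
    weight X ≤ κ :=
  add_le_of_le hκ (le_trans (csInf_le' ⟨𝓑, h𝓑, rfl⟩) h) hκ

theorem exists_isTopologicalBasis_le_weight (X : Type u) [TopologicalSpace X] :
    ∃ 𝓑 : Set (Set X), TopologicalSpace.IsTopologicalBasis 𝓑 ∧ #𝓑 ≤ weight X := by
  obtain ⟨𝓑, h𝓑, h⟩ := csInf_mem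
    (s := {κ : Cardinal.{u} | ∃ 𝓑 : Set (Set X), TopologicalSpace.IsTopologicalBasis 𝓑 ∧ #𝓑 = κ})
    ⟨_, _, TopologicalSpace.isTopologicalBasis_opens, rfl⟩
  exact ⟨𝓑, h𝓑, h.trans_le (self_le_add_right _ _)⟩

theorem seqDensity_le {X : Type u} {t : TopologicalSpace X} {κ : Cardinal.{u}} (hκ : ℵ₀ ≤ κ)
    {S : Set X} (hS : SeqDense t S) (h : #S ≤ κ) : seqDensity X t ≤ κ :=
  add_le_of_le hκ (le_trans (csInf_le' ⟨S, hS, rfl⟩) h) hκ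

theorem exists_seqDense_le_seqDensity (X : Type u) (t : TopologicalSpace X) :
    ∃ S : Set X, SeqDense t S ∧ #S ≤ seqDensity X t := by
  obtain ⟨S, hS, h⟩ := csInf_mem
    (s := {κ : Cardinal.{u} | ∃ S : Set X, SeqDense t S ∧ #S = κ})
    ⟨_, univ, fun x => ⟨fun _ => x, fun _ => mem_univ x, tendsto_const_nhds⟩, rfl⟩
  exact ⟨S, hS, h.trans_le (self_le_add_right _ _)⟩

/-- A compact space is of weight at most `κ` if `κ` continuous functions separate its points. -/
theorem weight_le_of_separating {X : Type u} [TopologicalSpace X] [CompactSpace X]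
    {S : Set C(X, ℝ)} (hS : ∀ x y, (∀ f ∈ S, f x = f y) → x = y) {κ : Cardinal.{u}}
    (hκ : ℵ₀ ≤ κ) (h : #S ≤ κ) : weight X ≤ κ := by
  set e : X → S → ℝ := fun x f => f.1 x with he
  have hcont : Continuous e := continuous_pi fun f => f.1.continuous
  have hinj : Function.Injective e := fun x y hxy => hS x y fun f hf => congrFun hxy ⟨f, hf⟩
  -- A continuous injection of a compact space into a Hausdorff one is an embedding.
  have hind := (hcont.isClosedEmbedding hinj).isInducing.eq_induced
  set T := TopologicalSpace.countableBasis ℝ with hT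
  set 𝓖 : Set (Set X) := range fun p : S × T => p.1.1 ⁻¹' p.2.1 with h𝓖
  have hgen : (inferInstance : TopologicalSpace X) = .generateFrom 𝓖 := by
    refine le_antisymm (le_generateFrom ?_) ?_
    · rintro _ ⟨⟨f, V⟩, rfl⟩
      exact (TopologicalSpace.isOpen_of_mem_countableBasis V.2).preimage f.1.continuous
    · rw [hind, ← continuous_iff_le_induced]
      refine @continuous_pi _ _ _ (_) _ _ fun f => ?_
      rw [TopologicalSpace.eq_generateFrom_countableBasis (α := ℝ)]
      refine continuous_generateFrom_iff.2 fun V hV => ?_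
      exact TopologicalSpace.isOpen_generateFrom_of_mem ⟨⟨f, ⟨V, hV⟩⟩, rfl⟩
  have hcard : #𝓖 ≤ κ := by
    have h1 : lift.{u} #T ≤ ℵ₀ := by
      rw [lift_le_aleph0]
      exact (TopologicalSpace.countable_countableBasis ℝ).le_aleph0
    have h2 : #𝓖 ≤ #(S × T) := by
      simpa using mk_range_le (f := fun p : S × T => p.1.1 ⁻¹' p.2.1)
    refine h2.trans ?_
    rw [mk_prod]
    refine mul_le_of_le hκ (by simpa using h) ?_
    simpa using h1.trans hκ
  obtain ⟨𝓑, h𝓑, h𝓑'⟩ := exists_isTopologicalBasis_of_generateFrom hgen hκ hcard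
  exact weight_le hκ h𝓑 h𝓑'

/-- By regularity, closures of basic sets form enough compact neighbourhoods to generate the
compact-open topology, with finite unions from a countable base of `ℝ` as targets. -/
theorem exists_isTopologicalBasis_continuousMap_le_weight (X : Type u) [TopologicalSpace X]
    [CompactSpace X] [T2Space X] :
    ∃ 𝓒 : Set (Set C(X, ℝ)), TopologicalSpace.IsTopologicalBasis 𝓒 ∧ #𝓒 ≤ weight X := by
  obtain ⟨𝓑, h𝓑, hcard⟩ := exists_isTopologicalBasis_le_weight X
  have hκ := aleph0_le_weight X
  refine exists_isTopologicalBasis_of_generateFrom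
    (ContinuousMap.compactOpen_eq_generateFrom (S := closure '' 𝓑) ?_
      (TopologicalSpace.isBasis_countableBasis ℝ) ?_) hκ ?_
  · rintro _ ⟨U, -, rfl⟩
    exact isClosed_closure.isCompact
  · intro f x V hV hx
    obtain ⟨U, hU, hxU, hUV⟩ := h𝓑.exists_closure_subset
      (f.continuous.continuousAt.preimage_mem_nhds
        ((TopologicalSpace.isOpen_of_mem_countableBasis hV).mem_nhds hx))
    exact ⟨_, ⟨U, hU, rfl⟩, mem_of_superset ((h𝓑.isOpen hU).mem_nhds hxU) subset_closure, hUV⟩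
  · set T := {t : Set (Set ℝ) | t.Finite ∧ t ⊆ TopologicalSpace.countableBasis ℝ} with hT
    have h1 : lift.{u} #T ≤ ℵ₀ := by
      rw [lift_le_aleph0]
      exact mk_finite_subsets_le _ le_rfl
        (TopologicalSpace.countable_countableBasis ℝ).le_aleph0
    rw [← image_uncurry_prod]
    refine mk_image_le.trans ?_
    rw [mk_congr (Equiv.Set.prod _ _), mk_prod]
    refine (mul_le_of_le hκ (by simpa using mk_image_le.trans hcard) ?_)
    simpa using h1.trans hκ

/-- Every subspace of a space with a base `𝓒` has a dense subset of cardinality at most `#𝓒`. -/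
theorem exists_dense_card_le {Y : Type u} [TopologicalSpace Y] {𝓒 : Set (Set Y)}
    (h𝓒 : TopologicalSpace.IsTopologicalBasis 𝓒) (A : Set Y) :
    ∃ S : Set A, Dense S ∧ #S ≤ #𝓒 := by
  have hbasis := h𝓒.induced ((↑) : A → Y)
  set 𝓓 : Set (Set A) := preimage (↑) '' 𝓒 with h𝓓
  set 𝓔 : Set 𝓓 := {U | U.1.Nonempty}
  -- One point is chosen in each nonempty trace of a basic set on `A`.
  refine ⟨range fun U : 𝓔 => U.2.some, ?_, mk_range_le.trans ((mk_set_le _).trans mk_image_le)⟩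
  refine hbasis.dense_iff.2 fun U hU hne => ?_
  exact ⟨_, hne.some_mem, ⟨⟨⟨U, hU⟩, hne⟩, rfl⟩⟩

end Weight

/-! ### Affine functions on `K` -/

section AffineFunctions

variable {E : Type u} [AddCommGroup E] [Module ℝ E] [TopologicalSpace E]

/-- `affineFunctions K` as a submodule. -/
def affineSubmodule (K : Set E) : Submodule ℝ C(K, ℝ) where
  carrier := affineFunctions K
  add_mem' := by
    intro f g hf hg x y z a b ha hb hab h
    have h1 := hf x y z a b ha hb hab h
    have h2 := hg x y z a b ha hb hab h
    simp only [ContinuousMap.add_apply]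
    linear_combination h1 + h2
  zero_mem' := by
    intro x y z a b ha hb hab h
    simp
  smul_mem' := by
    intro c f hf x y z a b ha hb hab h
    have h1 := hf x y z a b ha hb hab h
    simp only [ContinuousMap.smul_apply, smul_eq_mul]
    linear_combination c * h1

theorem isClosed_affineFunctions (K : Set E) : IsClosed (affineFunctions K) := by
  simp only [affineFunctions, ofPred_forall]
  refine isClosed_iInter fun x => isClosed_iInter fun y => isClosed_iInter fun z =>
    isClosed_iInter fun a => isClosed_iInter fun b => isClosed_iInter fun _ =>
    isClosed_iInter fun _ => isClosed_iInter fun _ => isClosed_iInter fun _ => ?_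
  exact isClosed_eq (continuous_eval_const z)
    (((continuous_eval_const x).const_mul a).add ((continuous_eval_const y).const_mul b))

theorem norm_le_one_of_mem_affineUnitBall {K : Set E} [CompactSpace K] {f : C(K, ℝ)}
    (hf : f ∈ affineUnitBall K) : ‖f‖ ≤ 1 :=
  (ContinuousMap.norm_le _ zero_le_one).2 hf.2

theorem tendsto_pointwiseTopology_iff {K : Set E} {B : Set K} {s : ℕ → affineUnitBall K}
    {f : affineUnitBall K} :
    Tendsto s atTop (@nhds _ (pointwiseTopology K B) f) ↔
      ∀ b ∈ B, Tendsto (fun n => (s n : C(K, ℝ)) b) atTop (𝓝 ((f : C(K, ℝ)) b)) := by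
  rw [nhds_induced, tendsto_comap_iff, tendsto_pi_nhds, Subtype.forall]
  rfl

/-- Rainwater–Simons applied to the differences `s n - f`, which lie in the closed subspace `A(K)`
and have norm at most `2`. -/
theorem pointwise_tendsto_of_pointwiseTopology {K : Set E} [CompactSpace K] {B : Set K}
    (hB : IsBoundary K B) {s : ℕ → affineUnitBall K} {f : affineUnitBall K}
    (h : Tendsto s atTop (@nhds _ (pointwiseTopology K B) f)) (x : K) :
    Tendsto (fun n => (s n : C(K, ℝ)) x) atTop (𝓝 ((f : C(K, ℝ)) x)) := by
  rw [tendsto_pointwiseTopology_iff] at h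
  refine tendsto_sub_nhds_zero_iff.1 ?_
  refine tendsto_zero_of_boundary (affineSubmodule K) (isClosed_affineFunctions K) B hB
    (fun n => (s n : C(K, ℝ)) - f) (fun n => (affineSubmodule K).sub_mem (s n).2.1 f.2.1) 2
    (fun n => ?_) (fun b hb => tendsto_sub_nhds_zero_iff.2 (h b hb)) x
  have h1 := norm_le_one_of_mem_affineUnitBall (s n).2
  have h2 := norm_le_one_of_mem_affineUnitBall f.2
  linarith [norm_sub_le (s n : C(K, ℝ)) f]

/-- A separating continuous functional is restricted to `K` and divided by its sup norm, which is
nonzero since it takes distinct values. -/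
theorem exists_affineUnitBall_ne [IsTopologicalAddGroup E] [ContinuousSMul ℝ E]
    [LocallyConvexSpace ℝ E] [T2Space E] (K : Set E) [CompactSpace K] {x y : K} (hxy : x ≠ y) :
    ∃ f ∈ affineUnitBall K, f x ≠ f y := by
  obtain ⟨φ, hφ⟩ := geometric_hahn_banach_point_point (Subtype.coe_injective.ne hxy)
  set g : C(K, ℝ) := ⟨fun z => φ z, φ.continuous.comp continuous_subtype_val⟩ with hg
  have hgA : g ∈ affineSubmodule K := by
    intro x y z a b _ _ _ h
    simp [hg, h]
  have hpos : 0 < ‖g‖ := norm_pos_iff.2 fun h0 => by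
    have h1 : φ x = 0 := DFunLike.congr_fun h0 x
    have h2 : φ y = 0 := DFunLike.congr_fun h0 y
    rw [h1, h2] at hφ
    exact lt_irrefl _ hφ
  refine ⟨‖g‖⁻¹ • g, ⟨(affineSubmodule K).smul_mem _ hgA, fun z => ?_⟩, ?_⟩
  · have := (‖g‖⁻¹ • g).norm_coe_le_norm z
    rwa [norm_smul, norm_inv, norm_norm, inv_mul_cancel₀ hpos.ne'] at this
  · intro h
    exact hφ.ne (mul_left_cancel₀ (inv_ne_zero hpos.ne') h)

/-- `Dense` refers to the sup-norm topology, which is metrizable, so closure points are limits of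
sequences. -/
theorem seqDense_pointwiseTopology_of_dense {K : Set E} [CompactSpace K] (B : Set K)
    {S : Set (affineUnitBall K)} (hS : Dense S) : SeqDense (pointwiseTopology K B) S := by
  intro f
  obtain ⟨s, hs, hsf⟩ := mem_closure_iff_seq_limit.1 (hS f)
  refine ⟨s, hs, tendsto_pointwiseTopology_iff.2 fun b _ => ?_⟩
  exact (((continuous_eval_const b).comp continuous_subtype_val).tendsto f).comp hsf

end AffineFunctions

theorem theoremt {E : Type u} [AddCommGroup E] [Module ℝ E] [TopologicalSpace E]
    [IsTopologicalAddGroup E] [ContinuousSMul ℝ E] [LocallyConvexSpace ℝ E] [T2Space E]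
    (K : Set E) (hKconv : Convex ℝ K) (hKcomp : IsCompact K)
    (B : Set K) (hB : IsBoundary K B) :
    weight K = seqDensity (affineUnitBall K) (pointwiseTopology K B) := by
  have : CompactSpace K := isCompact_iff_compactSpace.1 hKcomp
  apply le_antisymm
  · obtain ⟨S, hS, hcard⟩ := exists_seqDense_le_seqDensity (affineUnitBall K) (pointwiseTopology K B)
    refine weight_le_of_separating (S := (↑) '' S) (fun x y hxy => ?_) (self_le_add_left _ _)
      (mk_image_le.trans hcard)
    by_contra hne
    obtain ⟨f, hf, hfne⟩ := exists_affineUnitBall_ne K hne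
    obtain ⟨s, hs, hsf⟩ := hS ⟨f, hf⟩
    have hx := pointwise_tendsto_of_pointwiseTopology hB hsf x
    simp only [fun n => hxy _ ⟨s n, hs n, rfl⟩] at hx
    exact hfne (tendsto_nhds_unique hx (pointwise_tendsto_of_pointwiseTopology hB hsf y))
  · obtain ⟨𝓒, h𝓒, hcard⟩ := exists_isTopologicalBasis_continuousMap_le_weight K
    obtain ⟨S, hS, hScard⟩ := exists_dense_card_le h𝓒 (affineUnitBall K)
    exact seqDensity_le (aleph0_le_weight K) (seqDense_pointwiseTopology_of_dense B hS)
      (hScard.trans hcard)
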